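/- Notation. For a real Hilbert space $\mathcal{H}$, $\Gamma(\mathcal{H})$ is the set of proper, convex, lower semicontinuous functions $\varphi:\mathcal{H}\to[-\infty,+\infty]$; $\operatorname{dom}\varphi=\{x:\varphi(x)<+\infty\}$; $\varphi^*(p)=\sup_{x}\{\langle p,x\rangle-\varphi(x)\}$; $\partial\varphi(x)=\{p:\varphi(y)-\varphi(x)\ge\langle p,y-x\rangle\ \forall y\}$ if $\varphi(x)\in\mathbb{R}$ and $\partial\varphi(x)=\varnothing$ otherwise; $(\varphi\,\Box\,\psi)(x)=\inf_{y}\{\varphi(y)+\psi(x-y)\}$. For set-valued operators $A,B$ on $\mathcal{H}$, $A\,\Box\,B=(A^{-1}+B^{-1})^{-1}$ is the parallel sum and $\operatorname{ran}A=\bigcup_x A(x)$. For a convex set $\Omega$, $\operatorname{sqri}\Omega$ is the set of $x\in\Omega$ such that $\bigcup_{\lambda\ge0}\lambda(\Omega-x)$ is a closed linear subspace. Setting. Let $\mathcal{H}$ be a real Hilbert space, $z\in\mathcal{H}$, $f\in\Gamma(\mathcal{H})$, and let $h:\mathcal{H}\to\mathbb{R}$ be convex and differentiable with $\mu$-Lipschitz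 continuous gradient for some $\mu>0$. For $i=1,\dots,m$ let $\mathcal{G}_i,\mathcal{X}_i,\mathcal{Y}_i$ be real Hilbert spaces, $r_i\in\mathcal{G}_i$, $g_i\in\Gamma(\mathcal{X}_i)$, $l_i\in\Gamma(\mathcal{Y}_i)$, and let $L_i:\mathcal{H}\to\mathcal{G}_i$, $K_i:\mathcal{G}_i\to\mathcal{X}_i$, $M_i:\mathcal{G}_i\to\mathcal{Y}_i$ be nonzero bounded linear operators. Proposition. Suppose that the problem $$\inf_{x\in\mathcal{H}}\Big\{f(x)+\sum_{i=1}^m\big((g_i\circ K_i)\,\Box\,(l_i\circ M_i)\big)(L_ix-r_i)+h(x)-\langle x,z\rangle\Big\}$$ has an optimal solution, that $$0\in\operatorname{sqri}\big(\operatorname{dom}(g_i\circ K_i)^*-\operatorname{dom}(l_i\circ M_i)^*\big),\qquad i=1,\dots,m,$$ and that $0\in\operatorname{sqri}E$, where $E\subseteq\big(\bigoplus_{i=1}^m\mathcal{X}_i\big)\oplus\big(\bigoplus_{i=1}^m\mathcal{Y}_i\big)$ is the set $$E=\Big\{\big(K_i(L_ix-r_i-y_i)-a_i\big)_{i=1}^m\times\big(M_iy_i-b_i\big)_{i=1}^m:\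 x\in\operatorname{dom}f,\ y_i\in\mathcal{G}_i,\ a_i\in\operatorname{dom}g_i,\ b_i\in\operatorname{dom}l_i,\ i=1,\dots,m\Big\},$$ the point $x$ being the same for all $i$. Then $$z\in\operatorname{ran}\Big(\partial f+\sum_{i=1}^mL_i^*\big((K_i^*\circ\partial g_i\circ K_i)\,\Box\,(M_i^*\circ\partial l_i\circ M_i)\big)(L_i\,\cdot\,-r_i)+\nabla h\Big).$$ -/

import Mathlib

open scoped NNReal Pointwise Gradient

noncomputable section

/-- The effective domain of an extended-real-valued function. -/
def effDom {H : Type*} (f : H → EReal) : Set H := {x | f x < ⊤}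

/-- A function is proper if its effective domain is nonempty and it never takes the
value `-∞`. -/
def IsProperFun {H : Type*} (f : H → EReal) : Prop :=
  (effDom f).Nonempty ∧ ∀ x, ⊥ < f x

/-- Convexity of an extended-real-valued function: its epigraph is convex. -/
def IsConvexFun {H : Type*} [AddCommGroup H] [Module ℝ H] (f : H → EReal) : Prop :=
  Convex ℝ {p : H × ℝ | f p.1 ≤ (p.2 : EReal)}

/-- The class `Γ(H)` of proper, convex and lower semicontinuous functions. -/
def InGamma {H : Type*} [NormedAddCommGroup H] [InnerProductSpace ℝ H]
    (f : H → EReal) : Prop :=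
  IsProperFun f ∧ IsConvexFun f ∧ LowerSemicontinuous f

/-- The conjugate function `f^*(p) = sup_x (⟨p, x⟩ - f x)`. -/
def conjFun {H : Type*} [NormedAddCommGroup H] [InnerProductSpace ℝ H]
    (f : H → EReal) (p : H) : EReal :=
  ⨆ x : H, ((inner ℝ p x : ℝ) : EReal) - f x

/-- The infimal convolution `(f □ g)(x) = inf_y (f y + g (x - y))`. -/
def infConv {H : Type*} [AddCommGroup H] (f g : H → EReal) (x : H) : EReal :=
  ⨅ y : H, f y + g (x - y)

/-- The convex subdifferential, empty at the points where `f` is not finite. -/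
def subdiff {H : Type*} [NormedAddCommGroup H] [InnerProductSpace ℝ H]
    (f : H → EReal) (x : H) : Set H :=
  {p | f x ≠ ⊤ ∧ f x ≠ ⊥ ∧ ∀ y : H, ((inner ℝ p (y - x) : ℝ) : EReal) ≤ f y - f x}

/-- The inverse of a set-valued operator. -/
def opInv {H G : Type*} (A : H → Set G) (u : G) : Set H := {x | u ∈ A x}

/-- The range of a set-valued operator. -/
def opRan {H G : Type*} (A : H → Set G) : Set G := {u | ∃ x, u ∈ A x}

/-- The parallel sum `A □ B = (A⁻¹ + B⁻¹)⁻¹` of two set-valued operators. -/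
def parSum {H : Type*} [AddCommGroup H] (A B : H → Set H) : H → Set H :=
  opInv (fun u => opInv A u + opInv B u)

/-- The composition `K^* ∘ A ∘ K` of a set-valued operator `A` with a bounded linear operator
and its adjoint. -/
def adjComp {G X : Type*} [NormedAddCommGroup G] [InnerProductSpace ℝ G] [CompleteSpace G]
    [NormedAddCommGroup X] [InnerProductSpace ℝ X] [CompleteSpace X]
    (K : G →L[ℝ] X) (A : X → Set X) (x : G) : Set G :=
  K.adjoint '' (A (K x))

/-- The strong quasi-relative interior of a (nonempty, convex) set `Ω`: the points `x ∈ Ω` for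
which `⋃_{t ≥ 0} t (Ω - x)` is a closed linear subspace. -/
def sqri {E : Type*} [NormedAddCommGroup E] [NormedSpace ℝ E] (Ω : Set E) : Set E :=
  {x | x ∈ Ω ∧ ∃ S : Submodule ℝ E, IsClosed (S : Set E) ∧
    (S : Set E) = ⋃ (t : ℝ) (_ : 0 ≤ t), t • (Ω - {x})}

section Problem

variable {m : ℕ} {H : Type*} [NormedAddCommGroup H] [InnerProductSpace ℝ H]
  {G X Y : Fin m → Type*}
  [∀ i, NormedAddCommGroup (G i)] [∀ i, InnerProductSpace ℝ (G i)]
  [∀ i, NormedAddCommGroup (X i)] [∀ i, InnerProductSpace ℝ (X i)]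
  [∀ i, NormedAddCommGroup (Y i)] [∀ i, InnerProductSpace ℝ (Y i)]

/-- The objective
`f x + ∑ i, ((g i ∘ K i) □ (l i ∘ M i)) (L i x - r i) + h x - ⟨x, z⟩` of the primal problem. -/
def primalObjective (z : H) (f : H → EReal) (h : H → ℝ) (r : ∀ i, G i)
    (g : ∀ i, X i → EReal) (l : ∀ i, Y i → EReal)
    (L : ∀ i, H →L[ℝ] G i) (K : ∀ i, G i →L[ℝ] X i) (M : ∀ i, G i →L[ℝ] Y i)
    (x : H) : EReal :=
  f x + (∑ i, infConv (g i ∘ K i) (l i ∘ M i) (L i x - r i)) + (h x : EReal)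
    - ((inner ℝ x z : ℝ) : EReal)

/-- The set of all pairs of families
`((K i (L i x - r i - y i) - a i)_i, (M i (y i) - b i)_i)` with `x ∈ dom f`, `y i ∈ G i`,
`a i ∈ dom (g i)` and `b i ∈ dom (l i)`, in the Hilbert direct sum of all `X i` and `Y i`. The
point `x` is common to all the indices. -/
def constraintSet (f : H → EReal) (r : ∀ i, G i)
    (g : ∀ i, X i → EReal) (l : ∀ i, Y i → EReal)
    (L : ∀ i, H →L[ℝ] G i) (K : ∀ i, G i →L[ℝ] X i) (M : ∀ i, G i →L[ℝ] Y i) :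
    Set (WithLp 2 (PiLp 2 X × PiLp 2 Y)) :=
  {w | ∃ x ∈ effDom f, ∃ (y : ∀ i, G i) (a : ∀ i, X i) (b : ∀ i, Y i), ∀ i,
    a i ∈ effDom (g i) ∧ b i ∈ effDom (l i) ∧
    w.fst i = K i (L i x - r i - y i) - a i ∧ w.snd i = M i (y i) - b i}

end Problem

end

/-! The problem is lifted to variables x, y_i, a_i, b_i with heights above f, g_i, l_i, constrained
by a_i = K_i(L_i x - r_i - y_i) and b_i = M_i y_i. The condition on the conjugate domains makes each
infimal convolution exact (`exists_add_le_infConv`), so a primal minimiser lifts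
(`exists_epi_minimizer`). At the lifted minimiser h may be replaced by its linearisation
(`linearized_le_of_forall_le`), leaving a linear objective on the zero fibre of a closed convex
relation whose set of residuals is E. Since 0 ∈ sqri E, a multiplier exists
(`exists_multiplier_of_zero_mem_sqri`). Varying one variable at a time in the resulting Lagrangian
inequality yields subgradients of f, g_i, l_i, and the equality of adjoint images that the parallel
sum demands.

Both qualification conditions enter through that same multiplier theorem. On the closed subspace
generated by the residuals, Robinson–Ursescu bounds the value function above near 0, and Hahn–Banach
then separates. For exactness the theorem is applied to the epigraphs of the two conjugates: the
multiplier gives the optimal y, and Fenchel–Moreau returns from the conjugates to the functions. -/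

/-! ### Open mapping theorem for closed convex relations. -/

section ConvexOpenMapping

variable {Z S : Type*} [NormedAddCommGroup Z] [NormedSpace ℝ Z]
  [NormedAddCommGroup S] [NormedSpace ℝ S]

/-- Dyadic convex combinations of points of a convex set. -/
theorem Convex.dyadic_sum_mem {C : Set Z} (hC : Convex ℝ C) (c : ℕ → Z)
    (hc : ∀ n, c n ∈ C) (n : ℕ) :
    ∀ d ∈ C, (∑ k ∈ Finset.range n, ((1 / 2 : ℝ) ^ (k + 1)) • c k) + ((1 / 2 : ℝ) ^ n) • d ∈ C := by
  induction n with
  | zero => intro d hd; simpa using hd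
  | succ n ih =>
    intro d hd
    -- The new term and the tail have equal weights, so their midpoint serves as the tail of the
    -- shorter sum.
    have h1 : (1 / 2 : ℝ) • c n + (1 / 2 : ℝ) • d ∈ C :=
      hC (hc n) hd (by norm_num) (by norm_num) (by norm_num)
    have h2 := ih _ h1
    rw [Finset.sum_range_succ]
    convert h2 using 1
    module

/-- If the values reached by a closed convex relation with bounded first coordinate are dense in
a ball, then they contain the ball of half the radius. -/
theorem ball_half_subset_of_closure [CompleteSpace Z] {C : Set (Z × S)} (hC : Convex ℝ C)
    (hCc : IsClosed C) {R δ : ℝ} (hδ : 0 < δ)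
    (hball : Metric.ball (0 : S) δ ⊆ closure {w | ∃ z, ‖z‖ ≤ R ∧ (z, w) ∈ C}) (w : S)
    (hw : ‖w‖ < δ / 2) : ∃ z, ‖z‖ ≤ R ∧ (z, w) ∈ C := by
  have step : ∀ u : S, ‖u‖ < δ → ∃ q : Z × S, ‖q.1‖ ≤ R ∧ q ∈ C ∧ ‖u - q.2‖ < δ / 2 := by
    intro u hu
    obtain ⟨a, ⟨z, hz, hza⟩, ha⟩ :=
      Metric.mem_closure_iff.1 (hball (mem_ball_zero_iff.2 hu)) (δ / 2) (by linarith)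
    exact ⟨(z, a), hz, hza, by rwa [dist_eq_norm] at ha⟩
  choose! q hqR hqC hqd using step
  -- `u n` is the error after n dyadic corrections, magnified by 2 ^ (n + 1). An approximation error
  -- below δ / 2 doubles to less than δ, so the process never leaves the ball.
  let u : ℕ → S := fun n => Nat.rec ((2 : ℝ) • w) (fun _ v => (2 : ℝ) • (v - (q v).2)) n
  have hu1 : ∀ n, u (n + 1) = (2 : ℝ) • (u n - (q (u n)).2) := fun n => rfl
  have hu : ∀ n, ‖u n‖ < δ := by
    intro n
    induction n with
    | zero =>
      change ‖(2 : ℝ) • w‖ < δ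
      rw [norm_smul, Real.norm_two]; linarith
    | succ n ih =>
      rw [hu1, norm_smul, Real.norm_two]
      have := hqd _ ih
      linarith
  have hsum : ∀ n, (∑ k ∈ Finset.range n, ((1 / 2 : ℝ) ^ (k + 1)) • (q (u k)).2)
      = w - ((1 / 2 : ℝ) ^ (n + 1)) • u n := by
    intro n
    induction n with
    | zero =>
      have : u 0 = (2 : ℝ) • w := rfl
      simp [this, smul_smul]
    | succ n ih =>
      rw [Finset.sum_range_succ, ih, hu1]
      module
  have hgeo : HasSum (fun k : ℕ => (1 / 2 : ℝ) ^ (k + 1) * R) R := by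
    have := (hasSum_geometric_two.mul_left (1 / 2 : ℝ)).mul_right R
    simpa [pow_succ, mul_comm] using this
  have hbd : ∀ k, ‖((1 / 2 : ℝ) ^ (k + 1)) • (q (u k)).1‖ ≤ (1 / 2 : ℝ) ^ (k + 1) * R := by
    intro k
    rw [norm_smul, Real.norm_of_nonneg (by positivity)]
    exact mul_le_mul_of_nonneg_left (hqR _ (hu k)) (by positivity)
  have hz := (Summable.of_norm_bounded hgeo.summable hbd).hasSum
  refine ⟨_, (tsum_of_norm_bounded hgeo hbd), ?_⟩
  have hp : Filter.Tendsto (fun n : ℕ => (1 / 2 : ℝ) ^ n) Filter.atTop (nhds 0) :=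
    tendsto_pow_atTop_nhds_zero_of_lt_one (by norm_num) (by norm_num)
  have hlim2 : Filter.Tendsto (fun n : ℕ => w - ((1 / 2 : ℝ) ^ (n + 1)) • u n) Filter.atTop
      (nhds w) := by
    have h0 : Filter.Tendsto (fun n : ℕ => ((1 / 2 : ℝ) ^ (n + 1)) • u n) Filter.atTop
        (nhds 0) := by
      refine squeeze_zero_norm (a := fun n : ℕ => (1 / 2 : ℝ) ^ (n + 1) * δ) (fun n => ?_) ?_
      · rw [norm_smul, Real.norm_of_nonneg (by positivity)]
        exact mul_le_mul_of_nonneg_left (hu n).le (by positivity)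
      · simpa using ((Filter.tendsto_add_atTop_iff_nat 1).2 hp).mul_const δ
    simpa using tendsto_const_nhds.sub h0
  -- The partial sums have total weight 1 - 2 ^ (-n). The missing weight goes to the fixed point `q
  -- (u 0)`, whose contribution vanishes in the limit.
  have hmem := fun n => hC.dyadic_sum_mem (fun k => q (u k)) (fun k => hqC _ (hu k)) n
    _ (hqC _ (hu 0))
  refine hCc.mem_of_tendsto ?_ (Filter.Eventually.of_forall (f := Filter.atTop) hmem)
  have e : ((∑' k, ((1 / 2 : ℝ) ^ (k + 1)) • (q (u k)).1), w)
      = ((∑' k, ((1 / 2 : ℝ) ^ (k + 1)) • (q (u k)).1), w) + (0 : ℝ) • q (u 0) := by simp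
  rw [e]
  refine Filter.Tendsto.add ?_ (hp.smul_const _)
  refine Filter.Tendsto.congr (f₁ := fun n => (∑ k ∈ Finset.range n,
    ((1 / 2 : ℝ) ^ (k + 1)) • (q (u k)).1, w - ((1 / 2 : ℝ) ^ (n + 1)) • u n)) (fun n => ?_) ?_
  · ext
    · simp [Prod.fst_sum]
    · rw [← hsum]; simp [Prod.snd_sum]
  · exact (hz.tendsto_sum_nat).prodMk_nhds hlim2

/-- **Robinson–Ursescu**: a closed convex relation with absorbing range is open at the origin. -/
theorem exists_ball_subset_range_of_absorbing [CompleteSpace Z] [CompleteSpace S] {C : Set (Z × S)}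
    (hC : Convex ℝ C) (hCc : IsClosed C)
    (habs : ∀ w : S, ∃ t : ℝ, 0 < t ∧ ∃ z, (z, t • w) ∈ C) :
    ∃ R δ : ℝ, 0 < δ ∧ ∀ w, ‖w‖ < δ → ∃ z, ‖z‖ ≤ R ∧ (z, w) ∈ C := by
  obtain ⟨z₀, hz₀⟩ : ∃ z₀, (z₀, (0 : S)) ∈ C := by
    obtain ⟨t, -, z, hz⟩ := habs 0
    exact ⟨z, by simpa using hz⟩
  let A : ℕ → Set S := fun n => {w | ∃ z, ‖z‖ ≤ n ∧ (z, w) ∈ C}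
  have hA : ∀ n, Convex ℝ (A n) := by
    rintro n w ⟨z, hz, hzw⟩ w' ⟨z', hz', hzw'⟩ a b ha hb hab
    refine ⟨a • z + b • z', ?_, hC hzw hzw' ha hb hab⟩
    have := (convex_closedBall (0 : Z) n) (mem_closedBall_zero_iff.2 hz)
      (mem_closedBall_zero_iff.2 hz') ha hb hab
    exact mem_closedBall_zero_iff.1 this
  have hmono : ∀ {n k : ℕ}, n ≤ k → A n ⊆ A k := by
    rintro n k hnk w ⟨z, hz, hzw⟩
    exact ⟨z, hz.trans (by exact_mod_cast hnk), hzw⟩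
  -- Dilates of the closures, to which Baire's theorem applies; n + 1 keeps the scale invertible at
  -- n = 0.
  let F : ℕ → Set S := fun n => {w | ((n + 1 : ℝ)⁻¹) • w ∈ closure (A n)}
  have hF : ∀ n, IsClosed (F n) := fun n => isClosed_closure.preimage (continuous_const_smul _)
  have hU : (⋃ n, F n) = Set.univ := by
    refine Set.eq_univ_of_forall fun w => ?_
    obtain ⟨t, ht, z, hz⟩ := habs w
    obtain ⟨n, hn⟩ := exists_nat_ge (max t⁻¹ (max ‖z‖ ‖z₀‖))
    refine Set.mem_iUnion.2 ⟨n, subset_closure ?_⟩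
    have hn1 : t⁻¹ ≤ n := (le_max_left _ _).trans hn
    have hn2 : ‖z‖ ≤ n := ((le_max_left _ _).trans (le_max_right _ _)).trans hn
    have hn3 : ‖z₀‖ ≤ n := ((le_max_right _ _).trans (le_max_right _ _)).trans hn
    have h1 : (n + 1 : ℝ)⁻¹ * t⁻¹ ≤ 1 := by
      rw [inv_mul_le_iff₀ (by positivity)]; linarith
    have := hA n ⟨z, hn2, hz⟩ ⟨z₀, hn3, hz₀⟩ (a := (n + 1 : ℝ)⁻¹ * t⁻¹)
      (b := 1 - (n + 1 : ℝ)⁻¹ * t⁻¹) (by positivity) (by linarith) (by ring)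
    rw [smul_zero, add_zero, smul_smul, mul_assoc, inv_mul_cancel₀ ht.ne', mul_one] at this
    exact this
  obtain ⟨n, x, hx⟩ := nonempty_interior_of_iUnion_of_closed hF hU
  obtain ⟨ε, hε, hball⟩ := Metric.isOpen_iff.1 isOpen_interior x hx
  -- The interior point x given by Baire need not be 0; a range point in the direction -x is used to
  -- cancel it.
  obtain ⟨t, ht, z, hz⟩ := habs (-x)
  obtain ⟨k, hk⟩ := exists_nat_ge ‖z‖
  set N := max n k
  -- Normalises the weights t r and (n + 1)⁻¹ r, for which the two multiples of x cancel and a ball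
  -- of radius t r (n + 1)⁻¹ ε around 0 remains.
  set r : ℝ := (t + (n + 1 : ℝ)⁻¹)⁻¹ with hr
  have hr0 : 0 < r := by positivity
  refine ⟨N, t * r * (n + 1 : ℝ)⁻¹ * ε / 2, by positivity, fun w hw => ?_⟩
  refine ball_half_subset_of_closure hC hCc (δ := t * r * (n + 1 : ℝ)⁻¹ * ε) (by positivity)
    (fun v hv => ?_) w hw
  set c : ℝ := t * r * (n + 1 : ℝ)⁻¹ with hc
  have hc0 : 0 < c := by positivity
  have h1 : x + c⁻¹ • v ∈ F n := by
    refine interior_subset (hball ?_)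
    rw [mem_ball_iff_norm, add_sub_cancel_left, norm_smul, norm_inv, Real.norm_of_nonneg hc0.le,
      inv_mul_lt_iff₀ hc0]
    exact mem_ball_zero_iff.1 hv
  have h2 : ((n + 1 : ℝ)⁻¹) • (x + c⁻¹ • v) ∈ closure (A N) :=
    closure_mono (hmono (le_max_left _ _)) h1
  have h3 : t • (-x) ∈ closure (A N) :=
    subset_closure (hmono (le_max_right _ _) ⟨z, hk, hz⟩)
  have h4 := (hA N).closure h2 h3 (a := t * r) (b := (n + 1 : ℝ)⁻¹ * r) (by positivity)
    (by positivity) (by rw [← add_mul, hr]; exact mul_inv_cancel₀ (by positivity))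
  convert h4 using 1
  have : c * c⁻¹ = 1 := mul_inv_cancel₀ hc0.ne'
  calc v = (c * c⁻¹) • v := by rw [this, one_smul]
    _ = _ := by rw [hc]; module

end ConvexOpenMapping

/-! ### Lagrange multipliers. -/

section Duality

variable {Z W : Type*} [NormedAddCommGroup Z] [NormedSpace ℝ Z]
  [NormedAddCommGroup W] [InnerProductSpace ℝ W]

/-- A linear objective bounded below on the zero fibre of a closed convex relation with absorbing
range has a Lagrange multiplier. -/
theorem exists_multiplier_of_absorbing [CompleteSpace Z] [CompleteSpace W] {C : Set (Z × W)}
    (hC : Convex ℝ C) (hCc : IsClosed C)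
    (habs : ∀ w : W, ∃ t : ℝ, 0 < t ∧ ∃ z, (z, t • w) ∈ C)
    (c : Z →L[ℝ] ℝ) {t₀ : ℝ} (ht₀ : ∀ z, (z, (0 : W)) ∈ C → t₀ ≤ c z) :
    ∃ p : W, ∀ z w, (z, w) ∈ C → t₀ + inner ℝ p w ≤ c z := by
  obtain ⟨R, δ, hδ, hball⟩ := exists_ball_subset_range_of_absorbing hC hCc habs
  -- The strict epigraph of the value function; its interior is nonempty because the value is at
  -- most ‖c‖ R on the ball.
  let P : Set (W × ℝ) := {q | ∃ z, (z, q.1) ∈ C ∧ c z < q.2}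
  have hP : Convex ℝ P := by
    rintro ⟨w, s⟩ ⟨z, hz, hzs⟩ ⟨w', s'⟩ ⟨z', hz', hzs'⟩ a b ha hb hab
    refine ⟨a • z + b • z', hC hz hz' ha hb hab, ?_⟩
    have := (convex_Ioi (0 : ℝ)) (sub_pos.2 hzs) (sub_pos.2 hzs') ha hb hab
    simp only [smul_eq_mul, Set.mem_Ioi] at this
    simp only [map_add, map_smul, smul_eq_mul, Prod.smul_mk, Prod.mk_add_mk]
    linarith
  have h0 : ((0 : W), t₀) ∉ interior P := fun hmem => by
    obtain ⟨z, hz, hzt⟩ := interior_subset hmem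
    exact absurd (ht₀ z hz) (not_le.2 hzt)
  have hsub : Metric.ball (0 : W) δ ×ˢ Set.Ioi (‖c‖ * R) ⊆ P := by
    rintro ⟨w, s⟩ ⟨hw, hs⟩
    obtain ⟨z, hzR, hz⟩ := hball w (mem_ball_zero_iff.1 hw)
    refine ⟨z, hz, lt_of_le_of_lt ?_ hs⟩
    exact (le_abs_self _).trans ((c.le_opNorm z).trans
      (mul_le_mul_of_nonneg_left hzR (norm_nonneg _)))
  have hint : (interior P).Nonempty :=
    ⟨((0 : W), ‖c‖ * R + 1), interior_maximal hsub (Metric.isOpen_ball.prod isOpen_Ioi)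
      ⟨Metric.mem_ball_self hδ, by simp⟩⟩
  obtain ⟨φ, hφ0, hφ⟩ := geometric_hahn_banach_of_nonempty_interior_point hP h0 hint
  let ψ : W →L[ℝ] ℝ := φ.comp (ContinuousLinearMap.inl ℝ W ℝ)
  let γ : ℝ := φ (0, 1)
  have hdec : ∀ w s, φ (w, s) = ψ w + s * γ := by
    intro w s
    have : ((w, s) : W × ℝ) = (w, 0) + s • ((0 : W), (1 : ℝ)) := by simp
    rw [this, map_add, map_smul]; rfl
  have hle : ∀ w s, (w, s) ∈ P → ψ w + s * γ ≤ t₀ * γ := by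
    intro w s hws
    have := hφ _ hws
    rwa [hdec, hdec, map_zero, zero_add] at this
  have hγ : γ < 0 := by
    rcases lt_trichotomy γ 0 with h | h | h
    · exact h
    -- A vertical hyperplane is impossible: ψ would be nonpositive on a ball, hence zero, making φ
    -- zero.
    · exfalso
      have hψ : ∀ w, ‖w‖ < δ → ψ w ≤ 0 := fun w hw => by
        have := hle w (‖c‖ * R + 1) (hsub ⟨mem_ball_zero_iff.2 hw, by simp⟩)
        simpa [h] using this
      have hψ' : ∀ w, ψ w ≤ 0 := fun w => by
        have hpos : 0 < δ / (2 * (‖w‖ + 1)) := by positivity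
        have := hψ ((δ / (2 * (‖w‖ + 1))) • w) (by
          rw [norm_smul, Real.norm_of_nonneg hpos.le, div_mul_eq_mul_div,
            div_lt_iff₀ (by positivity)]
          nlinarith [norm_nonneg w])
        rw [map_smul, smul_eq_mul] at this
        exact nonpos_of_mul_nonpos_right this hpos
      refine hφ0 (ContinuousLinearMap.ext fun q => ?_)
      have h1 := hψ' q.1
      have h2 := hψ' (-q.1)
      rw [map_neg] at h2
      change φ (q.1, q.2) = 0
      rw [hdec, h]; linarith
    · exfalso
      have := hle 0 (max (‖c‖ * R + 1) (t₀ + 1)) (hsub ⟨Metric.mem_ball_self hδ,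
        Set.mem_Ioi.2 ((lt_add_one _).trans_le (le_max_left _ _))⟩)
      rw [map_zero, zero_add] at this
      have h2 := le_of_mul_le_mul_right this h
      have h3 := le_max_right (‖c‖ * R + 1) (t₀ + 1)
      linarith
  refine ⟨(InnerProductSpace.toDual ℝ W).symm ((-γ)⁻¹ • ψ), fun z w hz => ?_⟩
  rw [InnerProductSpace.toDual_symm_apply]
  refine le_of_forall_gt_imp_ge_of_dense fun s hs => ?_
  have h1 := hle w s ⟨z, hz, hs⟩
  change t₀ + (-γ)⁻¹ * ψ w ≤ s
  have h2 : (-γ)⁻¹ * ψ w ≤ s - t₀ := by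
    rw [inv_mul_le_iff₀ (by linarith)]; linarith
  linarith

/-- Lagrange multipliers under the Attouch–Brezis qualification condition. -/
theorem exists_multiplier_of_zero_mem_sqri [CompleteSpace Z] [CompleteSpace W] {C : Set (Z × W)}
    (hC : Convex ℝ C) (hCc : IsClosed C) (hq : (0 : W) ∈ sqri (Prod.snd '' C))
    (c : Z →L[ℝ] ℝ) {t₀ : ℝ} (ht₀ : ∀ z, (z, (0 : W)) ∈ C → t₀ ≤ c z) :
    ∃ p : W, ∀ z w, (z, w) ∈ C → t₀ + inner ℝ p w ≤ c z := by
  obtain ⟨⟨⟨z₀, w₀⟩, hz₀, h0⟩, S, hSc, hS⟩ := hq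
  obtain rfl : w₀ = 0 := h0
  have : CompleteSpace S := hSc.completeSpace_coe
  have hmem : ∀ z w, (z, w) ∈ C → w ∈ S := fun z w h => by
    have : w ∈ (S : Set W) := by
      rw [hS]
      refine Set.mem_iUnion₂.2 ⟨1, zero_le_one, ?_⟩
      rw [one_smul]
      exact ⟨w, ⟨_, h, rfl⟩, 0, rfl, sub_zero w⟩
    exact this
  -- All residuals lie in S, so nothing is lost by restricting to Z × S, where the range is
  -- absorbing.
  let J : Z × S →L[ℝ] Z × W := (ContinuousLinearMap.id ℝ Z).prodMap S.subtypeL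
  have habs : ∀ w : S, ∃ t : ℝ, 0 < t ∧ ∃ z, (z, t • w) ∈ J ⁻¹' C := by
    intro w
    have hw : (w : W) ∈ (S : Set W) := w.2
    rw [hS] at hw
    obtain ⟨t, ht, d, ⟨v, ⟨⟨z, v'⟩, hz, rfl⟩, o, ho, hd⟩, hw⟩ := Set.mem_iUnion₂.1 hw
    obtain rfl : o = 0 := ho
    simp only [sub_zero] at hd hw
    subst hd
    rcases ht.eq_or_lt with rfl | ht
    · have hw0 : w = 0 := Subtype.ext (by simpa using hw.symm)
      refine ⟨1, one_pos, z₀, ?_⟩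
      rw [hw0]
      simpa [J] using hz₀
    · refine ⟨t⁻¹, inv_pos.2 ht, z, ?_⟩
      change (z, t⁻¹ • (w : W)) ∈ C
      rw [← hw, inv_smul_smul₀ ht.ne']
      exact hz
  obtain ⟨p, hp⟩ := exists_multiplier_of_absorbing (C := J ⁻¹' C)
    (hC.linear_preimage J.toLinearMap) (hCc.preimage J.continuous) habs c
    (fun z hz => ht₀ z hz)
  exact ⟨p, fun z w h => hp z ⟨w, hmem z w h⟩ h⟩

end Duality

/-! ### Conjugates and exactness of the infimal convolution. -/

section Conjugate

theorem LowerSemicontinuous.isClosed_real_epigraph {G : Type*} [TopologicalSpace G]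
    {φ : G → EReal} (hφ : LowerSemicontinuous φ) :
    IsClosed {q : G × ℝ | φ q.1 ≤ (q.2 : EReal)} :=
  hφ.isClosed_epigraph.preimage (f := fun q : G × ℝ => (q.1, (q.2 : EReal)))
    (continuous_fst.prodMk (continuous_coe_real_ereal.comp continuous_snd))

variable {G : Type*} [NormedAddCommGroup G] [InnerProductSpace ℝ G]

/-- Points where φ is ⊤ constrain neither side. The epigraph of the conjugate thus becomes an
intersection of closed half-spaces, described by real inequalities only. -/
theorem conjFun_le_coe_iff {φ : G → EReal} (hφ : ∀ x, ⊥ < φ x) (a : G) (α : ℝ) :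
    conjFun φ a ≤ α ↔ ∀ (x : G) (t : ℝ), φ x ≤ t → inner ℝ a x - t ≤ α := by
  unfold conjFun
  rw [iSup_le_iff]
  refine forall_congr' fun x => ?_
  have hx := hφ x
  induction hφx : φ x using EReal.rec with
  | bot => simp [hφx] at hx
  | top => simp
  | coe s =>
    constructor
    · intro h t ht
      have h1 : inner ℝ a x - s ≤ α := by exact_mod_cast h
      have h2 : s ≤ t := by exact_mod_cast ht
      linarith
    · intro h
      exact_mod_cast h s le_rfl

theorem isClosed_epigraph_conjFun {φ : G → EReal} (hφ : ∀ x, ⊥ < φ x) :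
    IsClosed {q : G × ℝ | conjFun φ q.1 ≤ (q.2 : EReal)} := by
  simp only [conjFun_le_coe_iff hφ, Set.ofPred_forall]
  refine isClosed_iInter fun x => isClosed_iInter fun t => isClosed_iInter fun _ => ?_
  exact isClosed_le (by fun_prop) (by fun_prop)

theorem isConvexFun_conjFun {φ : G → EReal} (hφ : ∀ x, ⊥ < φ x) : IsConvexFun (conjFun φ) := by
  rintro ⟨a, α⟩ h ⟨b, β⟩ h' s t hs ht hst
  simp only [Set.mem_ofPred_eq, conjFun_le_coe_iff hφ] at h h' ⊢
  intro x τ hx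
  have h1 := mul_le_mul_of_nonneg_left (h x τ hx) hs
  have h2 := mul_le_mul_of_nonneg_left (h' x τ hx) ht
  simp only [Prod.smul_mk, Prod.mk_add_mk, smul_eq_mul, inner_add_left, real_inner_smul_left]
  have : τ = s * τ + t * τ := by rw [← add_mul, hst, one_mul]
  linarith

/-- **Fenchel–Moreau**: every value below `φ x` is exceeded by a continuous affine minorant. -/
theorem exists_conjFun_le_lt [CompleteSpace G] {φ : G → EReal} (hφ : ∀ x, ⊥ < φ x)
    (hconv : IsConvexFun φ) (hlsc : LowerSemicontinuous φ) (hdom : (effDom (conjFun φ)).Nonempty)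
    (hφd : (effDom φ).Nonempty)
    (x : G) {s : ℝ} (hs : (s : EReal) < φ x) :
    ∃ (a : G) (α : ℝ), conjFun φ a ≤ α ∧ s < inner ℝ a x - α := by
  obtain ⟨Λ, u, hu, hΛ⟩ := geometric_hahn_banach_point_closed hconv (hlsc.isClosed_real_epigraph)
    (x := (x, s)) (by simpa using hs)
  let p : G := (InnerProductSpace.toDual ℝ G).symm (Λ.comp (ContinuousLinearMap.inl ℝ G ℝ))
  let γ : ℝ := Λ (0, 1)
  have hdec : ∀ y t, Λ (y, t) = inner ℝ p y + t * γ := by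
    intro y t
    have : ((y, t) : G × ℝ) = (y, 0) + t • ((0 : G), (1 : ℝ)) := by simp
    rw [this, map_add, map_smul, InnerProductSpace.toDual_symm_apply]; rfl
  rw [hdec] at hu
  have hΛ' : ∀ y (t : ℝ), φ y ≤ t → u < inner ℝ p y + t * γ := fun y t h => by
    rw [← hdec]; exact hΛ (y, t) h
  have hγ : 0 ≤ γ := by
    by_contra! hneg
    obtain ⟨y, hy⟩ := hφd
    obtain ⟨t, ht, -⟩ := EReal.lt_iff_exists_real_btwn.1 hy
    have h1 := hΛ' y (max t ((u - inner ℝ p y) / γ))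
      (ht.le.trans (EReal.coe_le_coe_iff.2 (le_max_left _ _)))
    have h2 : max t ((u - inner ℝ p y) / γ) * γ ≤ (u - inner ℝ p y) / γ * γ :=
      mul_le_mul_of_nonpos_right (le_max_right _ _) hneg.le
    rw [div_mul_cancel₀ _ hneg.ne] at h2
    linarith
  rcases hγ.eq_or_lt with h | h
  · rw [← h] at hu hΛ'
    simp only [mul_zero, add_zero] at hu hΛ'
    obtain ⟨a₀, ha₀⟩ := hdom
    obtain ⟨α₀, hα₀, -⟩ := EReal.lt_iff_exists_real_btwn.1 ha₀
    have hα := (conjFun_le_coe_iff hφ _ _).1 hα₀.le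
    have hd : 0 < u - inner ℝ p x := by linarith
    obtain ⟨k, hk⟩ := exists_nat_gt ((s - (inner ℝ a₀ x - α₀)) / (u - inner ℝ p x))
    rw [div_lt_iff₀ hd] at hk
    -- The separating hyperplane is vertical. A known affine minorant is tilted by a multiple of u -
    -- ⟨p, ·⟩, which is negative on the domain and positive at x.
    refine ⟨a₀ - (k : ℝ) • p, α₀ - k * u, (conjFun_le_coe_iff hφ _ _).2 fun y t hy => ?_, ?_⟩
    · have h1 := hα y t hy
      have h2 := mul_le_mul_of_nonneg_left (hΛ' y t hy).le (Nat.cast_nonneg (α := ℝ) k)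
      rw [inner_sub_left, real_inner_smul_left]
      linarith
    · rw [inner_sub_left, real_inner_smul_left]
      linarith
  · refine ⟨-(γ⁻¹ • p), -(γ⁻¹ * u), (conjFun_le_coe_iff hφ _ _).2 fun y t hy => ?_, ?_⟩
    · have := mul_le_mul_of_nonneg_left (hΛ' y t hy).le (inv_pos.2 h).le
      rw [inner_neg_left, real_inner_smul_left]
      have h2 : γ⁻¹ * (inner ℝ p y + t * γ) = γ⁻¹ * inner ℝ p y + t := by field_simp
      linarith
    · have := mul_lt_mul_of_pos_left hu (inv_pos.2 h)
      rw [inner_neg_left, real_inner_smul_left]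
      have h2 : γ⁻¹ * (inner ℝ p x + s * γ) = γ⁻¹ * inner ℝ p x + s := by field_simp
      linarith

/-- Weak duality for the infimal convolution. -/
theorem coe_le_infConv {φ ψ : G → EReal} (hφ : ∀ x, ⊥ < φ x) (hψ : ∀ x, ⊥ < ψ x) {a : G}
    {α β : ℝ} (hα : conjFun φ a ≤ α) (hβ : conjFun ψ a ≤ β) (u : G) :
    ((inner ℝ a u - α - β : ℝ) : EReal) ≤ infConv φ ψ u := by
  refine le_iInf fun y => ?_
  have h1 := (conjFun_le_coe_iff hφ _ _).1 hα y
  have h2 := (conjFun_le_coe_iff hψ _ _).1 hβ (u - y)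
  rw [inner_sub_right] at h2
  have hy := hφ y
  have hy' := hψ (u - y)
  induction hφy : φ y using EReal.rec with
  | bot => simp [hφy] at hy
  | top => rw [EReal.top_add_of_ne_bot hy'.ne']; exact le_top
  | coe s =>
    induction hψy : ψ (u - y) using EReal.rec with
    | bot => simp [hψy] at hy'
    | top => simp
    | coe t =>
      have h1 := h1 s hφy.le
      have h2 := h2 t hψy.le
      have : inner ℝ a u - α - β ≤ s + t := by linarith
      exact_mod_cast this

/-- If the domains of the conjugates meet, the infimal convolution never takes the value `-∞`. -/
theorem bot_lt_infConv {φ ψ : G → EReal} (hφ : ∀ x, ⊥ < φ x) (hψ : ∀ x, ⊥ < ψ x)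
    (h : (0 : G) ∈ effDom (conjFun φ) - effDom (conjFun ψ)) (u : G) : ⊥ < infConv φ ψ u := by
  obtain ⟨a, ha, b, hb, hab⟩ := h
  obtain rfl : a = b := sub_eq_zero.1 hab
  obtain ⟨α, hα, -⟩ := EReal.lt_iff_exists_real_btwn.1 ha
  obtain ⟨β, hβ, -⟩ := EReal.lt_iff_exists_real_btwn.1 hb
  exact (EReal.bot_lt_coe _).trans_le (coe_le_infConv hφ hψ hα.le hβ.le u)

/-- Under the Attouch–Brezis condition on the conjugates the infimal convolution is exact. -/
theorem exists_add_le_infConv [CompleteSpace G] {φ ψ : G → EReal} (hφ : InGamma φ)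
    (hψ : InGamma ψ) (h : (0 : G) ∈ sqri (effDom (conjFun φ) - effDom (conjFun ψ))) (u : G)
    {τ : ℝ} (hτ : infConv φ ψ u = τ) :
    ∃ y, φ (u - y) + ψ y ≤ τ := by
  obtain ⟨⟨hφd, hφb⟩, hφc, hφl⟩ := hφ
  obtain ⟨⟨hψd, hψb⟩, hψc, hψl⟩ := hψ
  have hmeet := h.1
  let C : Set (((G × ℝ) × (G × ℝ)) × G) := {q | conjFun φ q.1.1.1 ≤ (q.1.1.2 : EReal) ∧
    conjFun ψ q.1.2.1 ≤ (q.1.2.2 : EReal) ∧ q.2 = q.1.1.1 - q.1.2.1}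
  have hC : Convex ℝ C := by
    rintro ⟨⟨q1, q2⟩, w⟩ ⟨h1, h2, h3⟩ ⟨⟨q1', q2'⟩, w'⟩ ⟨h1', h2', h3'⟩ s t hs ht hst
    refine ⟨isConvexFun_conjFun hφb h1 h1' hs ht hst, isConvexFun_conjFun hψb h2 h2' hs ht hst, ?_⟩
    simp only at h3 h3'
    simp only [h3, h3', Prod.smul_mk, Prod.mk_add_mk, Prod.fst_add, Prod.smul_fst]
    module
  have hCc : IsClosed C := by
    refine IsClosed.inter ((isClosed_epigraph_conjFun hφb).preimage (by fun_prop))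
      (IsClosed.inter ((isClosed_epigraph_conjFun hψb).preimage (by fun_prop)) ?_)
    exact isClosed_eq (by fun_prop) (by fun_prop)
  have hsnd : Prod.snd '' C = effDom (conjFun φ) - effDom (conjFun ψ) := by
    ext w
    constructor
    · rintro ⟨⟨⟨⟨a, α⟩, ⟨b, β⟩⟩, w⟩, ⟨h1, h2, h3⟩, rfl⟩
      exact ⟨a, h1.trans_lt (EReal.coe_lt_top _), b, h2.trans_lt (EReal.coe_lt_top _), h3.symm⟩
    · rintro ⟨a, ha, b, hb, rfl⟩
      obtain ⟨α, hα, -⟩ := EReal.lt_iff_exists_real_btwn.1 ha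
      obtain ⟨β, hβ, -⟩ := EReal.lt_iff_exists_real_btwn.1 hb
      exact ⟨(((a, α), (b, β)), a - b), ⟨hα.le, hβ.le, rfl⟩, rfl⟩
  let c : ((G × ℝ) × (G × ℝ)) →L[ℝ] ℝ :=
    ContinuousLinearMap.snd ℝ G ℝ ∘L ContinuousLinearMap.fst ℝ _ _
      + ContinuousLinearMap.snd ℝ G ℝ ∘L ContinuousLinearMap.snd ℝ _ _
      - innerSL ℝ u ∘L ContinuousLinearMap.fst ℝ G ℝ ∘L ContinuousLinearMap.fst ℝ _ _
  have hcval : ∀ a α b β, c ((a, α), (b, β)) = α + β - inner ℝ u a := fun a α b β => rfl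
  obtain ⟨p, hp⟩ := exists_multiplier_of_zero_mem_sqri hC hCc (by rwa [hsnd]) c (t₀ := -τ) (by
    rintro ⟨⟨a, α⟩, ⟨b, β⟩⟩ ⟨h1, h2, h3⟩
    obtain rfl : a = b := sub_eq_zero.1 h3.symm
    rw [hcval, real_inner_comm]
    have hlow := coe_le_infConv hφb hψb h1 h2 u
    rw [hτ] at hlow
    have : inner ℝ a u - α - β ≤ τ := by exact_mod_cast hlow
    linarith)
  -- The multiplier inequality reads (⟨a, u + p⟩ - α) + (⟨b, -p⟩ - β) ≤ τ; by Fenchel–Moreau its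
  -- left side approximates φ (u + p) + ψ (-p).
  refine ⟨-p, EReal.add_le_of_forall_lt fun s hs t ht => ?_⟩
  obtain ⟨s', hs1, hs2⟩ := EReal.lt_iff_exists_real_btwn.1 hs
  obtain ⟨t', ht1, ht2⟩ := EReal.lt_iff_exists_real_btwn.1 ht
  obtain ⟨a₀, ha₀, b₀, hb₀, -⟩ := hmeet
  obtain ⟨a, α, hα, hsa⟩ := exists_conjFun_le_lt hφb hφc hφl ⟨a₀, ha₀⟩ hφd _ hs2
  obtain ⟨b, β, hβ, htb⟩ := exists_conjFun_le_lt hψb hψc hψl ⟨b₀, hb₀⟩ hψd _ ht2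
  have := hp ((a, α), (b, β)) (a - b) ⟨hα, hβ, rfl⟩
  rw [hcval, inner_sub_right, real_inner_comm a u, real_inner_comm a p, real_inner_comm b p] at this
  rw [sub_neg_eq_add, inner_add_right] at hsa
  rw [inner_neg_right] at htb
  have hfin : s' + t' ≤ τ := by linarith
  calc s + t ≤ (s' : EReal) + t' := add_le_add hs1.le ht1.le
    _ ≤ τ := by exact_mod_cast hfin

end Conjugate

/-! ### Finite sums of extended reals. -/

section ERealSum

variable {ι : Type*}

theorem EReal.coe_sum_real (s : Finset ι) (τ : ι → ℝ) :
    ((∑ i ∈ s, τ i : ℝ) : EReal) = ∑ i ∈ s, (τ i : EReal) := by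
  classical
  induction s using Finset.induction_on with
  | empty => simp
  | insert i s hi ih => rw [Finset.sum_insert hi, Finset.sum_insert hi, EReal.coe_add, ih]

theorem EReal.bot_lt_sum (s : Finset ι) {v : ι → EReal} (hv : ∀ i, ⊥ < v i) :
    ⊥ < ∑ i ∈ s, v i := by
  classical
  induction s using Finset.induction_on with
  | empty => simp
  | insert i s hi ih =>
    rw [Finset.sum_insert hi]
    exact EReal.bot_lt_add_iff.2 ⟨hv i, ih⟩

theorem EReal.lt_top_of_sum_lt_top [Fintype ι] {v : ι → EReal} (hv : ∀ i, ⊥ < v i)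
    (h : ∑ i, v i < ⊤) (i : ι) : v i < ⊤ := by
  classical
  rw [lt_top_iff_ne_top]
  intro hi
  rw [← Finset.add_sum_erase _ _ (Finset.mem_univ i), hi,
    EReal.top_add_of_ne_bot (EReal.bot_lt_sum _ hv).ne'] at h
  exact lt_irrefl _ h

theorem EReal.exists_coe_eq {a : EReal} (h : ⊥ < a) (h' : a < ⊤) : ∃ r : ℝ, a = r :=
  ⟨a.toReal, (EReal.coe_toReal h'.ne h.ne').symm⟩

end ERealSum

/-- If `F = ∑ i, F i` is minimised over a product at `v`, each coordinate of `v` minimises its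
term. -/
theorem le_of_forall_sum_le {ι : Type*} [Fintype ι] {V : ι → Type*} (Q : ∀ i, V i → Prop)
    (F : ∀ i, V i → ℝ) (v : ∀ i, V i) (hv : ∀ i, Q i (v i))
    (h : ∀ w : ∀ i, V i, (∀ i, Q i (w i)) → ∑ i, F i (v i) ≤ ∑ i, F i (w i))
    (j : ι) (w : V j) (hw : Q j w) : F j (v j) ≤ F j w := by
  classical
  have hQ : ∀ i, Q i (Function.update v j w i) := by
    intro i
    by_cases hij : i = j
    · subst hij; simpa using hw
    · simpa [Function.update_of_ne hij] using hv i
  have := h _ hQ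
  rw [← Finset.add_sum_erase _ _ (Finset.mem_univ j),
    ← Finset.add_sum_erase _ (fun i => F i (Function.update v j w i)) (Finset.mem_univ j),
    Function.update_self] at this
  have e : ∑ i ∈ Finset.univ.erase j, F i (Function.update v j w i)
      = ∑ i ∈ Finset.univ.erase j, F i (v i) := Finset.sum_congr rfl fun i hi => by
    rw [Function.update_of_ne (Finset.ne_of_mem_erase hi)]
  rw [e] at this
  exact (add_le_add_iff_right _).1 this

/-! ### Subgradients, composition and linearisation. -/

section Convex

variable {H : Type*} [NormedAddCommGroup H] [InnerProductSpace ℝ H]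

theorem mem_subdiff_of_forall {f : H → EReal} (hf : ∀ x, ⊥ < f x) {x p : H} {σ : ℝ}
    (hσ : f x = σ) (h : ∀ y (t : ℝ), f y ≤ t → σ + inner ℝ p (y - x) ≤ t) : p ∈ subdiff f x := by
  refine ⟨by simp [hσ], by simp [hσ], fun y => ?_⟩
  rw [hσ]
  have hy := hf y
  induction hfy : f y using EReal.rec with
  | bot => simp [hfy] at hy
  | top => simp
  | coe t =>
    have := h y t hfy.le
    have : inner ℝ p (y - x) ≤ t - σ := by linarith
    exact_mod_cast this

/-- Only properness can be lost under composition, when the range of `K` misses the domain of `g`;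
`hd` excludes this. -/
theorem InGamma.comp_clm {X : Type*} [NormedAddCommGroup X] [InnerProductSpace ℝ X]
    {g : X → EReal} (hg : InGamma g) (K : H →L[ℝ] X) (hd : (effDom (g ∘ K)).Nonempty) :
    InGamma (g ∘ K) := by
  obtain ⟨⟨-, hb⟩, hc, hl⟩ := hg
  refine ⟨⟨hd, fun x => hb _⟩, ?_, hl.comp K.continuous⟩
  exact hc.linear_preimage (K.prodMap (ContinuousLinearMap.id ℝ ℝ)).toLinearMap

/-- At a minimiser over a convex set of a linear function plus a differentiable one, the
differentiable function may be replaced by its linearisation. -/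
theorem linearized_le_of_forall_le [CompleteSpace H] {Z : Type*} [NormedAddCommGroup Z]
    [NormedSpace ℝ Z] {D : Set Z} (hD : Convex ℝ D) (c : Z →L[ℝ] ℝ) (A : Z →L[ℝ] H) {h : H → ℝ}
    {z₀ : Z} (hz₀ : z₀ ∈ D) (hh : DifferentiableAt ℝ h (A z₀))
    (hmin : ∀ z ∈ D, c z₀ + h (A z₀) ≤ c z + h (A z)) (z : Z) (hz : z ∈ D) :
    c z₀ + inner ℝ (gradient h (A z₀)) (A z₀) ≤ c z + inner ℝ (gradient h (A z₀)) (A z) := by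
  have hlim := (((hasGradientAt_iff_hasFDerivAt.1 hh.hasGradientAt).hasLineDerivAt
    (A z - A z₀)).tendsto_slope_zero_right)
  -- Minimality along the segment from z₀ to z bounds the difference quotients of h below; then t
  -- tends to 0 from the right.
  have key : c z₀ - c z ≤ (InnerProductSpace.toDual ℝ H) (gradient h (A z₀)) (A z - A z₀) := by
    refine ge_of_tendsto hlim ?_
    filter_upwards [Ioo_mem_nhdsGT (zero_lt_one (α := ℝ))] with t ht
    have h1 := hmin _ (hD hz₀ hz (sub_nonneg.2 ht.2.le) ht.1.le (by ring))
    have h2 : A ((1 - t) • z₀ + t • z) = A z₀ + t • (A z - A z₀) := by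
      simp only [map_add, map_smul]; module
    rw [h2, map_add, map_smul, map_smul] at h1
    simp only [smul_eq_mul] at h1 ⊢
    rw [le_inv_mul_iff₀ ht.1]
    linarith
  rw [InnerProductSpace.toDual_apply_apply, inner_sub_right] at key
  linarith

end Convex

/-! ### The epigraphical form of the primal problem. -/

section CompositeProblem

variable {m : ℕ} {H : Type*} [NormedAddCommGroup H] [InnerProductSpace ℝ H]
  {G X Y : Fin m → Type*}
  [∀ i, NormedAddCommGroup (G i)] [∀ i, InnerProductSpace ℝ (G i)]
  [∀ i, NormedAddCommGroup (X i)] [∀ i, InnerProductSpace ℝ (X i)]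
  [∀ i, NormedAddCommGroup (Y i)] [∀ i, InnerProductSpace ℝ (Y i)]

/-- The space of primal variables of the composite problem, with epigraphical coordinates:
`((x, s), (y i, (a i, α i), (b i, β i))_i)`. -/
abbrev EpiSpace (H : Type*) (G X Y : Fin m → Type*) : Type _ :=
  (H × ℝ) × ∀ i, G i × (X i × ℝ) × (Y i × ℝ)

/-- Points of the epigraphs of `f`, `g i`, `l i`, related to the residuals of the constraints
`a i = K i (L i x - r i - y i)` and `b i = M i (y i)`. -/
def residualRelation (f : H → EReal) (r : ∀ i, G i)
    (g : ∀ i, X i → EReal) (l : ∀ i, Y i → EReal)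
    (L : ∀ i, H →L[ℝ] G i) (K : ∀ i, G i →L[ℝ] X i) (M : ∀ i, G i →L[ℝ] Y i) :
    Set (EpiSpace H G X Y × WithLp 2 (PiLp 2 X × PiLp 2 Y)) :=
  {q | f q.1.1.1 ≤ (q.1.1.2 : EReal) ∧ ∀ i,
    g i (q.1.2 i).2.1.1 ≤ ((q.1.2 i).2.1.2 : EReal) ∧
    l i (q.1.2 i).2.2.1 ≤ ((q.1.2 i).2.2.2 : EReal) ∧
    q.2.fst i = K i (L i q.1.1.1 - r i - (q.1.2 i).1) - (q.1.2 i).2.1.1 ∧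
    q.2.snd i = M i (q.1.2 i).1 - (q.1.2 i).2.2.1}

/-- The linear objective `s + ∑ i, (α i + β i) + ⟨v, x⟩`. -/
def epiObjective (v : H) : EpiSpace H G X Y →L[ℝ] ℝ where
  toFun q := q.1.2 + ∑ i, ((q.2 i).2.1.2 + (q.2 i).2.2.2) + inner ℝ v q.1.1
  map_add' q q' := by
    simp only [Prod.fst_add, Prod.snd_add, Pi.add_apply, inner_add_right, Finset.sum_add_distrib]
    ring
  map_smul' t q := by
    simp only [Prod.smul_fst, Prod.smul_snd, Pi.smul_apply, inner_smul_right, smul_eq_mul,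
      ← mul_add, ← Finset.mul_sum, RingHom.id_apply]
  cont := by fun_prop

theorem epiObjective_apply (v : H) (q : EpiSpace H G X Y) :
    epiObjective v q = q.1.2 + ∑ i, ((q.2 i).2.1.2 + (q.2 i).2.2.2) + inner ℝ v q.1.1 := rfl

variable {f : H → EReal} {r : ∀ i, G i} {g : ∀ i, X i → EReal} {l : ∀ i, Y i → EReal}
  {L : ∀ i, H →L[ℝ] G i} {K : ∀ i, G i →L[ℝ] X i} {M : ∀ i, G i →L[ℝ] Y i}

theorem convex_residualRelation (hf : IsConvexFun f) (hg : ∀ i, IsConvexFun (g i))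
    (hl : ∀ i, IsConvexFun (l i)) : Convex ℝ (residualRelation f r g l L K M) := by
  rintro ⟨⟨⟨x, s⟩, v⟩, w⟩ ⟨h1, h2⟩ ⟨⟨⟨x', s'⟩, v'⟩, w'⟩ ⟨h1', h2'⟩ a b ha hb hab
  refine ⟨hf h1 h1' ha hb hab, fun i => ⟨hg i (h2 i).1 (h2' i).1 ha hb hab,
    hl i (h2 i).2.1 (h2' i).2.1 ha hb hab, ?_, ?_⟩⟩
  · have e := (h2 i).2.2.1
    have e' := (h2' i).2.2.1
    simp only [Prod.smul_mk, Prod.mk_add_mk, WithLp.add_fst, WithLp.smul_fst, PiLp.add_apply,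
      PiLp.smul_apply, Pi.add_apply, Pi.smul_apply, Prod.fst_add, Prod.snd_add, Prod.smul_fst,
      Prod.smul_snd, map_add, map_sub, map_smul] at e e' ⊢
    rw [e, e']
    -- The shift by `r i` makes this constraint affine, so the weights must sum to 1.
    obtain rfl : b = 1 - a := by linarith
    module
  · have e := (h2 i).2.2.2
    have e' := (h2' i).2.2.2
    simp only [Prod.smul_mk, Prod.mk_add_mk, WithLp.add_snd, WithLp.smul_snd, PiLp.add_apply,
      PiLp.smul_apply, Pi.add_apply, Pi.smul_apply, Prod.fst_add, Prod.snd_add, Prod.smul_fst,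
      Prod.smul_snd, map_add, map_smul] at e e' ⊢
    rw [e, e']
    module

theorem isClosed_residualRelation (hf : LowerSemicontinuous f)
    (hg : ∀ i, LowerSemicontinuous (g i)) (hl : ∀ i, LowerSemicontinuous (l i)) :
    IsClosed (residualRelation f r g l L K M) := by
  simp only [residualRelation, Set.ofPred_and, Set.ofPred_forall]
  refine IsClosed.inter (hf.isClosed_real_epigraph.preimage
    (f := fun q : EpiSpace H G X Y × WithLp 2 (PiLp 2 X × PiLp 2 Y) => q.1.1) (by fun_prop)) ?_
  refine isClosed_iInter fun i => ?_
  refine IsClosed.inter ((hg i).isClosed_real_epigraph.preimage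
    (f := fun q : EpiSpace H G X Y × WithLp 2 (PiLp 2 X × PiLp 2 Y) => (q.1.2 i).2.1)
    (by fun_prop)) ?_
  refine IsClosed.inter ((hl i).isClosed_real_epigraph.preimage
    (f := fun q : EpiSpace H G X Y × WithLp 2 (PiLp 2 X × PiLp 2 Y) => (q.1.2 i).2.2)
    (by fun_prop)) ?_
  exact (isClosed_eq (by fun_prop) (by fun_prop)).inter (isClosed_eq (by fun_prop) (by fun_prop))

/-- Transfers the condition 0 ∈ sqri E to the relation; each point of an effective domain admits a
real height. -/
theorem image_snd_residualRelation :
    Prod.snd '' residualRelation f r g l L K M = constraintSet f r g l L K M := by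
  ext w
  constructor
  · rintro ⟨⟨⟨⟨x, s⟩, v⟩, w⟩, ⟨h1, h2⟩, rfl⟩
    exact ⟨x, h1.trans_lt (EReal.coe_lt_top _), fun i => (v i).1, fun i => (v i).2.1.1,
      fun i => (v i).2.2.1, fun i => ⟨(h2 i).1.trans_lt (EReal.coe_lt_top _),
        (h2 i).2.1.trans_lt (EReal.coe_lt_top _), (h2 i).2.2.1, (h2 i).2.2.2⟩⟩
  · rintro ⟨x, hx, y, a, b, h⟩
    obtain ⟨s, hs, -⟩ := EReal.lt_iff_exists_real_btwn.1 hx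
    choose α hα _ using fun i => EReal.lt_iff_exists_real_btwn.1 (h i).1
    choose β hβ _ using fun i => EReal.lt_iff_exists_real_btwn.1 (h i).2.1
    exact ⟨(((x, s), fun i => (y i, (a i, α i), (b i, β i))), w),
      ⟨hs.le, fun i => ⟨(hα i).le, (hβ i).le, (h i).2.2.1, (h i).2.2.2⟩⟩, rfl⟩

/-- Every feasible point of the epigraphical problem bounds the primal objective from above. -/
theorem primalObjective_le (z : H) (h : H → ℝ) {q : EpiSpace H G X Y}
    (hq : (q, 0) ∈ residualRelation f r g l L K M) :
    primalObjective z f h r g l L K M q.1.1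
      ≤ ((epiObjective (-z) q + h q.1.1 : ℝ) : EReal) := by
  obtain ⟨h1, h2⟩ := hq
  have hi : ∀ i, infConv (g i ∘ K i) (l i ∘ M i) (L i q.1.1 - r i)
      ≤ (((q.2 i).2.1.2 + (q.2 i).2.2.2 : ℝ) : EReal) := by
    intro i
    obtain ⟨ha, hb, e1, e2⟩ := h2 i
    refine (iInf_le _ (L i q.1.1 - r i - (q.2 i).1)).trans ?_
    rw [EReal.coe_add]
    refine add_le_add ?_ ?_
    · have : (q.2 i).2.1.1 = K i (L i q.1.1 - r i - (q.2 i).1) := (sub_eq_zero.1 e1.symm).symm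
      rw [Function.comp_apply, ← this]; exact ha
    · have : (q.2 i).2.2.1 = M i (q.2 i).1 := (sub_eq_zero.1 e2.symm).symm
      rw [sub_sub_cancel, Function.comp_apply, ← this]; exact hb
  have hsum := Finset.sum_le_sum fun i (_ : i ∈ Finset.univ) => hi i
  rw [← EReal.coe_sum_real] at hsum
  unfold primalObjective
  refine (EReal.sub_le_sub (add_le_add (add_le_add h1 hsum) le_rfl) le_rfl).trans (le_of_eq ?_)
  rw [epiObjective_apply, inner_neg_left, real_inner_comm]
  norm_cast
  ring

/-- A minimiser of the primal problem lifts to a minimiser of the epigraphical problem. -/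
theorem exists_epi_minimizer [∀ i, CompleteSpace (G i)] {z : H} {h : H → ℝ}
    (hf : ∀ x, ⊥ < f x) (hg : ∀ i, InGamma (g i)) (hl : ∀ i, InGamma (l i))
    (h_conj : ∀ i, (0 : G i) ∈
      sqri (effDom (conjFun (g i ∘ K i)) - effDom (conjFun (l i ∘ M i))))
    {q₁ : EpiSpace H G X Y} (hq₁ : (q₁, 0) ∈ residualRelation f r g l L K M) {x₀ : H}
    (hx₀ : ∀ x : H,
      primalObjective z f h r g l L K M x₀ ≤ primalObjective z f h r g l L K M x) :
    ∃ q₀ : EpiSpace H G X Y, (q₀, 0) ∈ residualRelation f r g l L K M ∧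
      f q₀.1.1 = q₀.1.2 ∧ (∀ i, g i (q₀.2 i).2.1.1 = ((q₀.2 i).2.1.2 : EReal)) ∧
      (∀ i, l i (q₀.2 i).2.2.1 = ((q₀.2 i).2.2.2 : EReal)) ∧
      ∀ q, (q, 0) ∈ residualRelation f r g l L K M →
        epiObjective (-z) q₀ + h q₀.1.1 ≤ epiObjective (-z) q + h q.1.1 := by
  -- The feasible point `q₁` shows that the compositions are proper; below it also bounds the
  -- optimal value away from ⊤.
  have hgK : ∀ i, InGamma (g i ∘ K i) := fun i => (hg i).comp_clm (K i)
    ⟨_, by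
      have e : (q₁.2 i).2.1.1 = K i _ := (sub_eq_zero.1 (hq₁.2 i).2.2.1.symm).symm
      have := (hq₁.2 i).1
      rw [e] at this
      exact this.trans_lt (EReal.coe_lt_top _)⟩
  have hlM : ∀ i, InGamma (l i ∘ M i) := fun i => (hl i).comp_clm (M i)
    ⟨_, by
      have e : (q₁.2 i).2.2.1 = M i _ := (sub_eq_zero.1 (hq₁.2 i).2.2.2.symm).symm
      have := (hq₁.2 i).2.1
      rw [e] at this
      exact this.trans_lt (EReal.coe_lt_top _)⟩
  have hbot : ∀ i, ⊥ < infConv (g i ∘ K i) (l i ∘ M i) (L i x₀ - r i) := fun i =>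
    bot_lt_infConv (hgK i).1.2 (hlM i).1.2 (h_conj i).1 _
  have htop : primalObjective z f h r g l L K M x₀ < ⊤ :=
    ((hx₀ _).trans (primalObjective_le z h hq₁)).trans_lt (EReal.coe_lt_top _)
  have hfin : f x₀ + ∑ i, infConv (g i ∘ K i) (l i ∘ M i) (L i x₀ - r i) < ⊤ := by
    rw [lt_top_iff_ne_top]
    intro e
    rw [primalObjective, e] at htop
    simp at htop
  have hsb := EReal.bot_lt_sum Finset.univ hbot
  have hft : f x₀ < ⊤ := by
    rw [lt_top_iff_ne_top]
    intro e
    rw [e, EReal.top_add_of_ne_bot hsb.ne'] at hfin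
    exact lt_irrefl _ hfin
  have hst : ∑ i, infConv (g i ∘ K i) (l i ∘ M i) (L i x₀ - r i) < ⊤ := by
    rw [lt_top_iff_ne_top]
    intro e
    rw [e, EReal.add_top_of_ne_bot (hf x₀).ne'] at hfin
    exact lt_irrefl _ hfin
  obtain ⟨σ, hσ⟩ := EReal.exists_coe_eq (hf x₀) hft
  choose τ hτ using fun i => EReal.exists_coe_eq (hbot i) (EReal.lt_top_of_sum_lt_top hbot hst i)
  choose y hy using fun i => exists_add_le_infConv (hgK i) (hlM i) (h_conj i) _ (hτ i)
  have hy' : ∀ i, g i (K i (L i x₀ - r i - y i)) + l i (M i (y i)) < ⊤ := fun i =>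
    (hy i).trans_lt (EReal.coe_lt_top _)
  choose α hα using fun i => EReal.exists_coe_eq ((hg i).1.2 (K i (L i x₀ - r i - y i)))
    (lt_top_iff_ne_top.2 fun e => by
      have := hy' i
      rw [e, EReal.top_add_of_ne_bot ((hl i).1.2 _).ne'] at this
      exact lt_irrefl _ this)
  choose β hβ using fun i => EReal.exists_coe_eq ((hl i).1.2 (M i (y i)))
    (lt_top_iff_ne_top.2 fun e => by
      have := hy' i
      rw [e, EReal.add_top_of_ne_bot ((hg i).1.2 _).ne'] at this
      exact lt_irrefl _ this)
  refine ⟨((x₀, σ), fun i => (y i, (K i (L i x₀ - r i - y i), α i), (M i (y i), β i))),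
    ⟨hσ.le, fun i => ⟨(hα i).le, (hβ i).le, by simp, by simp⟩⟩, hσ, hα, hβ, fun q hq => ?_⟩
  have hle := (hx₀ _).trans (primalObjective_le z h hq)
  have hval : primalObjective z f h r g l L K M x₀
      = ((σ + ∑ i, τ i + h x₀ - inner ℝ x₀ z : ℝ) : EReal) := by
    rw [primalObjective, hσ, Finset.sum_congr rfl fun i _ => hτ i, ← EReal.coe_sum_real]
    norm_cast
  rw [hval, EReal.coe_le_coe_iff] at hle
  refine le_trans ?_ hle
  rw [epiObjective_apply, inner_neg_left, real_inner_comm]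
  have hsum : ∑ i, (α i + β i) ≤ ∑ i, τ i := Finset.sum_le_sum fun i _ => by
    have := hy i
    simp only [Function.comp_apply, hα, hβ] at this
    exact_mod_cast this
  simp only
  linarith

end CompositeProblem

/-! ### The optimality condition. -/

theorem mainTheorem3 {m : ℕ}
    {H : Type*} [NormedAddCommGroup H] [InnerProductSpace ℝ H] [CompleteSpace H]
    {G X Y : Fin m → Type*}
    [∀ i, NormedAddCommGroup (G i)] [∀ i, InnerProductSpace ℝ (G i)] [∀ i, CompleteSpace (G i)]
    [∀ i, NormedAddCommGroup (X i)] [∀ i, InnerProductSpace ℝ (X i)] [∀ i, CompleteSpace (X i)]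
    [∀ i, NormedAddCommGroup (Y i)] [∀ i, InnerProductSpace ℝ (Y i)] [∀ i, CompleteSpace (Y i)]
    (z : H) (f : H → EReal) (hf : InGamma f)
    (h : H → ℝ) (h_convex : ConvexOn ℝ Set.univ h) (h_diff : Differentiable ℝ h)
    (μ : ℝ≥0) (hμ : 0 < μ) (h_lip : LipschitzWith μ (gradient h))
    (r : ∀ i, G i)
    (g : ∀ i, X i → EReal) (hg : ∀ i, InGamma (g i))
    (l : ∀ i, Y i → EReal) (hl : ∀ i, InGamma (l i))
    (L : ∀ i, H →L[ℝ] G i) (hL : ∀ i, L i ≠ 0)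
    (K : ∀ i, G i →L[ℝ] X i) (hK : ∀ i, K i ≠ 0)
    (M : ∀ i, G i →L[ℝ] Y i) (hM : ∀ i, M i ≠ 0)
    (h_opt : ∃ x₀ : H, ∀ x : H,
      primalObjective z f h r g l L K M x₀ ≤ primalObjective z f h r g l L K M x)
    (h_conj : ∀ i, (0 : G i) ∈
      sqri (effDom (conjFun (g i ∘ K i)) - effDom (conjFun (l i ∘ M i))))
    (h_E : (0 : WithLp 2 (PiLp 2 X × PiLp 2 Y)) ∈ sqri (constraintSet f r g l L K M)) :
    z ∈ opRan (fun x : H =>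
      subdiff f x
        + (∑ i, (L i).adjoint ''
            (parSum (adjComp (K i) (subdiff (g i))) (adjComp (M i) (subdiff (l i)))) (L i x - r i))
        + {gradient h x}) := by
  rw [← image_snd_residualRelation] at h_E
  obtain ⟨⟨q₁, w₁⟩, hq₁, h0⟩ := h_E.1
  obtain rfl : w₁ = 0 := h0
  obtain ⟨x', hx'⟩ := h_opt
  obtain ⟨⟨⟨x₀, σ⟩, v₀⟩, hq₀, hσ, hα, hβ, hmin⟩ :=
    exists_epi_minimizer hf.1.2 hg hl h_conj hq₁ hx'
  have hconv := convex_residualRelation (r := r) (L := L) (K := K) (M := M) hf.2.1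
    (fun i => (hg i).2.1) (fun i => (hl i).2.1)
  have hclosed := isClosed_residualRelation (r := r) (L := L) (K := K) (M := M) hf.2.2
    (fun i => (hg i).2.2) (fun i => (hl i).2.2)
  have hlin := linearized_le_of_forall_le
    (D := ContinuousLinearMap.inl ℝ (EpiSpace H G X Y) (WithLp 2 (PiLp 2 X × PiLp 2 Y)) ⁻¹'
      residualRelation f r g l L K M) (hconv.linear_preimage
        (ContinuousLinearMap.inl ℝ (EpiSpace H G X Y) _).toLinearMap)
    (epiObjective (-z))
    (ContinuousLinearMap.fst ℝ H ℝ ∘L ContinuousLinearMap.fst ℝ _ _) hq₀ (h_diff _) hmin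
  simp only [ContinuousLinearMap.comp_apply, ContinuousLinearMap.coe_fst'] at hlin
  set d : H := gradient h x₀ with hd
  obtain ⟨p, hp⟩ := exists_multiplier_of_zero_mem_sqri hconv hclosed h_E (epiObjective (d - z))
    (t₀ := epiObjective (d - z) ((x₀, σ), v₀)) (fun q hq => by
      have := hlin q hq
      simp only [epiObjective_apply, inner_sub_left, inner_neg_left] at this ⊢
      linarith)
  -- The i-th summand of the Lagrangian; for fixed x the sum is separable over i.
  let F : ∀ i, H → G i × (X i × ℝ) × (Y i × ℝ) → ℝ := fun i x v =>
    v.2.1.2 + v.2.2.2 - inner ℝ (p.fst i) (K i (L i x - r i - v.1) - v.2.1.1)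
      - inner ℝ (p.snd i) (M i v.1 - v.2.2.1)
  let Q : ∀ i, G i × (X i × ℝ) × (Y i × ℝ) → Prop := fun i v =>
    g i v.2.1.1 ≤ (v.2.1.2 : EReal) ∧ l i v.2.2.1 ≤ (v.2.2.2 : EReal)
  have ha₀ : ∀ i, K i (L i x₀ - r i - (v₀ i).1) = (v₀ i).2.1.1 := fun i =>
    sub_eq_zero.1 (hq₀.2 i).2.2.1.symm
  have hb₀ : ∀ i, M i (v₀ i).1 = (v₀ i).2.2.1 := fun i => sub_eq_zero.1 (hq₀.2 i).2.2.2.symm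
  have hQ₀ : ∀ i, Q i (v₀ i) := fun i => ⟨(hα i).le, (hβ i).le⟩
  have hF₀ : ∀ i, F i x₀ (v₀ i) = (v₀ i).2.1.2 + (v₀ i).2.2.2 := fun i => by
    simp only [F, ha₀, hb₀, sub_self, inner_zero_right, sub_zero]
  have hmain : ∀ x (s : ℝ) (v : ∀ i, G i × (X i × ℝ) × (Y i × ℝ)), f x ≤ s → (∀ i, Q i (v i)) →
      σ + ∑ i, F i x₀ (v₀ i) + inner ℝ (d - z) x₀ ≤ s + ∑ i, F i x (v i) + inner ℝ (d - z) x := by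
    intro x s v hx hv
    have := hp ((x, s), v) (WithLp.toLp 2 (WithLp.toLp 2 fun i =>
      K i (L i x - r i - (v i).1) - (v i).2.1.1, WithLp.toLp 2 fun i => M i (v i).1 - (v i).2.2.1))
      ⟨hx, fun i => ⟨(hv i).1, (hv i).2, rfl, rfl⟩⟩
    rw [WithLp.prod_inner_apply, PiLp.inner_apply, PiLp.inner_apply, epiObjective_apply,
      epiObjective_apply] at this
    simp only [hF₀, F, Finset.sum_sub_distrib]
    simp only [Finset.sum_add_distrib] at this ⊢
    change _ + (∑ i, inner ℝ (p.fst i) (K i (L i x - r i - (v i).1) - (v i).2.1.1)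
      + ∑ i, inner ℝ (p.snd i) (M i (v i).1 - (v i).2.2.1)) ≤ _ at this
    linarith
  have hcoord : ∀ i v, Q i v → F i x₀ (v₀ i) ≤ F i x₀ v := fun i v hv =>
    le_of_forall_sum_le Q (fun i => F i x₀) v₀ hQ₀ (fun w hw => by
      have := hmain x₀ σ w hσ.le hw
      linarith) i v hv
  have hgp : ∀ i, -p.fst i ∈ subdiff (g i) (v₀ i).2.1.1 := fun i =>
    mem_subdiff_of_forall (hg i).1.2 (hα i) fun a t ht => by
      have := hcoord i ((v₀ i).1, (a, t), (v₀ i).2.2) ⟨ht, (hβ i).le⟩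
      rw [hF₀] at this
      simp only [F, ha₀, hb₀, sub_self, inner_zero_right] at this
      simp only [inner_neg_left, inner_sub_right] at this ⊢
      linarith
  have hlp : ∀ i, -p.snd i ∈ subdiff (l i) (v₀ i).2.2.1 := fun i =>
    mem_subdiff_of_forall (hl i).1.2 (hβ i) fun b t ht => by
      have := hcoord i ((v₀ i).1, (v₀ i).2.1, (b, t)) ⟨(hα i).le, ht⟩
      rw [hF₀] at this
      simp only [F, ha₀, hb₀, sub_self, inner_zero_right] at this
      simp only [inner_neg_left, inner_sub_right] at this ⊢
      linarith
  -- The variable y is unconstrained and enters linearly, so minimality forces its coefficient to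
  -- vanish.
  have hadj : ∀ i, (K i).adjoint (-p.fst i) = (M i).adjoint (-p.snd i) := fun i => by
    have key : ∀ y, inner ℝ ((M i).adjoint (p.snd i) - (K i).adjoint (p.fst i)) y ≤ 0 := fun y => by
      have := hcoord i ((v₀ i).1 + y, (v₀ i).2) (hQ₀ i)
      rw [hF₀] at this
      simp only [F, map_add, hb₀, ← sub_sub, map_sub _ _ y, ha₀] at this
      rw [inner_sub_left, ContinuousLinearMap.adjoint_inner_left,
        ContinuousLinearMap.adjoint_inner_left]
      simp only [sub_sub_cancel_left, add_sub_cancel_left, inner_neg_right] at this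
      linarith
    have := key ((M i).adjoint (p.snd i) - (K i).adjoint (p.fst i))
    have := sub_eq_zero.1 (real_inner_self_nonpos.1 this)
    rw [map_neg, map_neg, this]
  have hfp : z - d + ∑ i, (L i).adjoint ((K i).adjoint (p.fst i)) ∈ subdiff f x₀ :=
    mem_subdiff_of_forall hf.1.2 hσ fun x t ht => by
      have := hmain x t v₀ ht hQ₀
      have e : ∀ i, F i x (v₀ i) = F i x₀ (v₀ i)
          - inner ℝ ((L i).adjoint ((K i).adjoint (p.fst i))) (x - x₀) := fun i => by
        rw [ContinuousLinearMap.adjoint_inner_left, ContinuousLinearMap.adjoint_inner_left]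
        simp only [F, map_sub, inner_sub_right]
        ring
      simp only [e, Finset.sum_sub_distrib] at this
      rw [inner_add_left, sum_inner]
      simp only [inner_sub_left, inner_sub_right] at this ⊢
      linarith
  refine ⟨x₀, Set.mem_add.2 ⟨_, Set.add_mem_add hfp (Set.finsetSum_mem_finsetSum _ _
    (fun i => (L i).adjoint ((K i).adjoint (-p.fst i))) fun i _ => ⟨_, ?_, rfl⟩), d, rfl, ?_⟩⟩
  -- The optimal y splits L_i x₀ - r_i into two points where both operators contain the same vector,
  -- as `hadj` ensures.
  · refine Set.mem_add.2 ⟨L i x₀ - r i - (v₀ i).1, ?_, (v₀ i).1, ?_, sub_add_cancel _ _⟩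
    · exact ⟨_, by rw [ha₀]; exact hgp i, rfl⟩
    · exact ⟨_, by rw [hb₀]; exact hlp i, (hadj i).symm⟩
  · simp only [map_neg, Finset.sum_neg_distrib]
    abel
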